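/- For $n\ge 1$ let $S_n$ be the set of permutations of $[n]=\{1,\dots,n\}$ with the Kendall-tau distance, i.e. the distance between $\pi,\sigma\in S_n$ is the number of pairs $i<j$ with $\operatorname{sgn}(\pi(i)-\pi(j))=-\operatorname{sgn}(\sigma(i)-\sigma(j))$; the distance from $\pi$ to the identity is then the number of inversions $I(\pi)=\#\{(i,j):1\le i<j\le n,\ \pi(i)>\pi(j)\}$. Let $f_n:S_n\to S_{n-1}$ ($n>1$) be the projection that deletes the last entry $\pi(n)$ and relabels $\pi(1),\dots,\pi(n-1)$ by the increasing bijection with $[n-1]$. A virtual permutation is a sequence $(\pi_1,\pi_2,\dots)$ with $\pi_n\in S_n$ and $f_n(\pi_n)=\pi_{n-1}$ for $n>1$; the space of virtual permutations carries the $\sigma$-algebra generated by the coordinates. A random virtual permutation $(\Pi_1,\Pi_2,\dots)$ is infinitely spherically symmetric (ISS) if, for every $n$, $\mathbb P(\Pi_n=\pi)$ depends on $\pi\in S_n$ only through the Kendall-tau distance from $\pi$ to the identity. The laws of ISS random virtual permutations form a convex set. Theorem. For every $q\in[0,\infty]$ there is exactly one law of a random virtual permutation with $$\mathbb P(\Pi_n=\pi)=\frac{q^{I(\pi)}}{[n]_q!},\qquad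 \pi\in S_n,\ n=1,2,\dots,$$ where $[n]_q!=\prod_{j=1}^n[j]_q$ and $[j]_q=1+q+\dots+q^{j-1}$, and where for $q=\infty$ the right-hand side is read as $1$ if $\pi$ is the decreasing permutation $(n,n-1,\dots,1)$ and as $0$ otherwise (for $q=0$, with $0^0=1$, it is the point mass at the identity). These Mallows laws, $q\in[0,\infty]$, and only they, are the extreme points of the convex set of laws of ISS random virtual permutations. -/

import Mathlib

open MeasureTheory
open scoped ENNReal NNReal

namespace KendallTau

/-- The Kendall-tau distance on permutations of `n` letters: the number of discordant pairs of
positions `i < j`, i.e. of pairs on which `π` and `σ` induce opposite orders. -/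
def dist {n : ℕ} (π σ : Equiv.Perm (Fin n)) : ℕ :=
  (Finset.univ.filter fun p : Fin n × Fin n =>
    p.1 < p.2 ∧ ((π p.1 < π p.2 ∧ σ p.2 < σ p.1) ∨ (π p.2 < π p.1 ∧ σ p.1 < σ p.2))).card

/-- The number of inversions `I(π)`. -/
def inversions {n : ℕ} (π : Equiv.Perm (Fin n)) : ℕ :=
  (Finset.univ.filter fun p : Fin n × Fin n => p.1 < p.2 ∧ π p.2 < π p.1).card

/-- The Kendall-tau distance to the identity is the number of inversions. -/
theorem dist_one_eq_inversions {n : ℕ} (π : Equiv.Perm (Fin n)) : dist π 1 = inversions π := by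
  refine congrArg Finset.card (Finset.filter_congr fun p _ => ?_)
  constructor
  · rintro ⟨h, h' | h'⟩
    · exact absurd h h'.2.asymm
    · exact ⟨h, h'.1⟩
  · rintro ⟨h, h'⟩
    exact ⟨h, Or.inr ⟨h', h⟩⟩

/-- The projection from permutations of `n + 1` letters to permutations of `n` letters: delete the
last entry of the one-line notation and relabel the remaining entries by the increasing bijection
(here `finSuccAboveEquiv a` is the increasing bijection from `Fin n` onto `Fin (n + 1)` without
`a`). -/
def proj {n : ℕ} (π : Equiv.Perm (Fin (n + 1))) : Equiv.Perm (Fin n) :=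
  ((finSuccAboveEquiv (Fin.last n)).trans
    (π.subtypeEquiv (p := fun i => i ≠ Fin.last n) (q := fun j => j ≠ π (Fin.last n))
      (fun _ => π.injective.ne_iff.symm))).trans
    (finSuccAboveEquiv (π (Fin.last n))).symm

/-- The space of virtual permutations: the projective limit of the symmetric groups along `proj`.
The component at `n = 0` lives in a one-point set and carries no information. -/
abbrev VirtualPerm : Type :=
  {ω : (n : ℕ) → Equiv.Perm (Fin n) // ∀ n, proj (ω (n + 1)) = ω n}

/-- The discrete σ-algebra on the finite set of permutations. The space `VirtualPerm` then carries
the σ-algebra generated by the coordinates, as a subspace of the product. -/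
instance permMeasurableSpace (n : ℕ) : MeasurableSpace (Equiv.Perm (Fin n)) := ⊤

/-- The law `μ` of a random virtual permutation is infinitely spherically symmetric: for every `n`
the probability of `Π_n = π` depends only on the distance from `π` to the identity. -/
def IsISS (μ : Measure VirtualPerm) : Prop :=
  ∀ (n : ℕ) (π σ : Equiv.Perm (Fin n)), dist π 1 = dist σ 1 →
    μ {ω | ω.1 n = π} = μ {ω | ω.1 n = σ}

/-- The convex set of all laws of infinitely spherically symmetric random virtual permutations. -/
def issLaws : Set (Measure VirtualPerm) :=
  {μ | IsProbabilityMeasure μ ∧ IsISS μ}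

/-- `[j]_q = 1 + q + ⋯ + q ^ (j - 1)`. -/
noncomputable def qNumber (q : ℝ≥0∞) (j : ℕ) : ℝ≥0∞ :=
  ∑ i ∈ Finset.range j, q ^ i

/-- `[n]_q! = [1]_q [2]_q ⋯ [n]_q`. -/
noncomputable def qFactorial (q : ℝ≥0∞) (n : ℕ) : ℝ≥0∞ :=
  ∏ j ∈ Finset.range n, qNumber q (j + 1)

/-- The Mallows probability of a permutation: `q ^ I(π) / [n]_q!` for finite `q`, and the point
mass at the decreasing permutation for `q = ∞`. (For `q = 0` the formula is the point mass at
the identity, as `0 ^ 0 = 1`.) -/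
noncomputable def mallowsProb (q : ℝ≥0∞) {n : ℕ} (π : Equiv.Perm (Fin n)) : ℝ≥0∞ :=
  if q = ∞ then (if π = Fin.revPerm then 1 else 0)
  else q ^ inversions π / qFactorial q n

/-- `μ` is the law of a Mallows virtual permutation with parameter `q`. -/
def IsMallows (q : ℝ≥0∞) (μ : Measure VirtualPerm) : Prop :=
  IsProbabilityMeasure μ ∧
    ∀ (n : ℕ) (π : Equiv.Perm (Fin n)), μ {ω | ω.1 n = π} = mallowsProb q π

end KendallTau

namespace KendallTau

/-! Deleting the last of `n + 1` entries removes between `0` and `n` inversions, each number for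
exactly one value of that entry. ISS laws therefore correspond, bijectively and affinely, to
nonnegative functions with `v 0 0 = 1` and `v n k = ∑ j ≤ n, v (n + 1) (k + j)`
(`exists_weight_of_mem_issLaws`, `exists_hasWeight`).

An extreme `v` is geometric in `k`. Restrict the increment at a late step `M` to `0, …, M - 1`, or
to `1, …, M`. The two restrictions are translates of each other and together cover all increments.
Their limits as `M → ∞` are harmonic and dominated by `v`, hence equal to `a • v` and `b • v`;
translation gives `a * v n (k + 1) = b * v n k`, with `a + b ≥ 1` (`exists_ratio_of_extreme`).
Harmonicity fixes the normalization (`eq_ratioWeight`), and `q = b / a`.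

Conversely, a linear form in the probabilities of the third increment is nonnegative on all
geometric weights and vanishes at only one. By Krein–Milman that weight is its only minimizer on
`weightSet`, hence extreme (`ratioWeight_mem_extremePoints`). -/

open Filter Topology

/-! ### Harmonic functions on the graph of inversion counts -/

/-- The nonnegative harmonic functions on the graph of inversion counts: the value at `(n, k)` is
to be thought of as the mass of each permutation of `n` letters with `k` inversions. -/
def harmonicCone : Set (ℕ → ℕ → ℝ) :=
  {v | (∀ n k, 0 ≤ v n k) ∧ (∀ n k, n.choose 2 < k → v n k = 0) ∧
    ∀ n k, k ≤ n.choose 2 → v n k = ∑ j ∈ Finset.range (n + 1), v (n + 1) (k + j)}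

/-- The normalized harmonic functions. -/
def weightSet : Set (ℕ → ℕ → ℝ) :=
  {v | v ∈ harmonicCone ∧ v 0 0 = 1}

theorem choose_succ_two (n : ℕ) : (n + 1).choose 2 = n.choose 2 + n := by
  rw [Nat.choose_succ_succ' n 1, Nat.choose_one_right, add_comm]

/-- Each vertex has a parent one level down, `min k (n.choose 2)` being one, and a parent's value is
a sum of nonnegative terms that includes its child's. -/
theorem harmonicCone.le_apply_zero {v : ℕ → ℕ → ℝ} (hv : v ∈ harmonicCone) (n k : ℕ) :
    v n k ≤ v 0 0 := by
  obtain ⟨h0, hz, hh⟩ := hv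
  induction n generalizing k with
  | zero =>
    rcases Nat.eq_zero_or_pos k with rfl | hk
    · exact le_rfl
    · rw [hz 0 k (by simpa using hk)]; exact h0 0 0
  | succ n ih =>
    by_cases hk : k ≤ (n + 1).choose 2
    · rw [choose_succ_two] at hk
      refine le_trans ?_ (ih (min k (n.choose 2)))
      rw [hh n _ (min_le_right _ _)]
      have := Finset.single_le_sum (s := Finset.range (n + 1))
        (f := fun j => v (n + 1) (min k (n.choose 2) + j)) (fun j _ => h0 _ _)
        (show k - min k (n.choose 2) ∈ Finset.range (n + 1) by
          rw [Finset.mem_range]; omega)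
      simpa [Nat.add_sub_cancel' (min_le_left k (n.choose 2))] using this
    · rw [hz _ _ (not_le.1 hk)]; exact h0 0 0

theorem smul_mem_harmonicCone {v : ℕ → ℕ → ℝ} (hv : v ∈ harmonicCone) {c : ℝ} (hc : 0 ≤ c) :
    c • v ∈ harmonicCone := by
  obtain ⟨h0, hz, hh⟩ := hv
  refine ⟨fun n k => mul_nonneg hc (h0 n k), fun n k hk => ?_, fun n k hk => ?_⟩
  · simp [hz n k hk]
  · simp [hh n k hk, Finset.mul_sum]

theorem add_mem_harmonicCone {v w : ℕ → ℕ → ℝ} (hv : v ∈ harmonicCone) (hw : w ∈ harmonicCone) :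
    v + w ∈ harmonicCone := by
  refine ⟨fun n k => add_nonneg (hv.1 n k) (hw.1 n k), fun n k hk => ?_, fun n k hk => ?_⟩
  · simp [hv.2.1 n k hk, hw.2.1 n k hk]
  · simp [hv.2.2 n k hk, hw.2.2 n k hk, Finset.sum_add_distrib]

theorem sub_mem_harmonicCone {v w : ℕ → ℕ → ℝ} (hv : v ∈ harmonicCone) (hw : w ∈ harmonicCone)
    (h : ∀ n k, w n k ≤ v n k) : v - w ∈ harmonicCone := by
  refine ⟨fun n k => sub_nonneg.2 (h n k), fun n k hk => ?_, fun n k hk => ?_⟩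
  · simp [hv.2.1 n k hk, hw.2.1 n k hk]
  · simp [hv.2.2 n k hk, hw.2.2 n k hk, Finset.sum_sub_distrib]

theorem eq_zero_of_mem_harmonicCone {v : ℕ → ℕ → ℝ} (hv : v ∈ harmonicCone) (h : v 0 0 = 0) :
    v = 0 := by
  funext n k
  exact le_antisymm ((harmonicCone.le_apply_zero hv n k).trans_eq h) (hv.1 n k)

theorem convex_weightSet : Convex ℝ weightSet := by
  rintro v ⟨hv, hv0⟩ w ⟨hw, hw0⟩ a b ha hb hab
  refine ⟨add_mem_harmonicCone (smul_mem_harmonicCone hv ha) (smul_mem_harmonicCone hw hb), ?_⟩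
  simp [hv0, hw0, hab]

theorem isClosed_weightSet : IsClosed weightSet := by
  have hc : ∀ n k, Continuous fun v : ℕ → ℕ → ℝ => v n k := fun n k => by fun_prop
  have : weightSet = (⋂ n, ⋂ k, {v : ℕ → ℕ → ℝ | 0 ≤ v n k}) ∩
      (⋂ n, ⋂ k, ⋂ _ : n.choose 2 < k, {v | v n k = 0}) ∩
      (⋂ n, ⋂ k, ⋂ _ : k ≤ n.choose 2,
        {v | v n k = ∑ j ∈ Finset.range (n + 1), v (n + 1) (k + j)}) ∩ {v | v 0 0 = 1} := by
    ext v
    simp only [weightSet, harmonicCone, Set.mem_ofPred_eq, Set.mem_inter_iff, Set.mem_iInter,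
      and_assoc]
  rw [this]
  refine ((IsClosed.inter ?_ ?_).inter ?_).inter ?_
  · exact isClosed_iInter fun n => isClosed_iInter fun k =>
      isClosed_le continuous_const (hc n k)
  · exact isClosed_iInter fun n => isClosed_iInter fun k => isClosed_iInter fun _ =>
      isClosed_eq (hc n k) continuous_const
  · exact isClosed_iInter fun n => isClosed_iInter fun k => isClosed_iInter fun _ =>
      isClosed_eq (hc n k) (continuous_finsetSum _ fun j _ => hc _ _)
  · exact isClosed_eq (hc 0 0) continuous_const

theorem isCompact_weightSet : IsCompact weightSet := by
  refine IsCompact.of_isClosed_subset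
    (isCompact_univ_pi fun _ : ℕ => isCompact_univ_pi fun _ : ℕ => isCompact_Icc (a := (0 : ℝ))
      (b := 1)) isClosed_weightSet ?_
  rintro v ⟨hv, hv0⟩ n - k -
  exact ⟨hv.1 n k, hv0 ▸ harmonicCone.le_apply_zero hv n k⟩

/-- A harmonic function dominated by an extreme one is proportional to it. -/
theorem eq_smul_of_le_extreme {v u : ℕ → ℕ → ℝ} (hv : v ∈ Set.extremePoints ℝ weightSet)
    (hu : u ∈ harmonicCone) (h : ∀ n k, u n k ≤ v n k) : u = u 0 0 • v := by
  obtain ⟨⟨hvc, hv0⟩, hext⟩ := hv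
  have hsub := sub_mem_harmonicCone hvc hu h
  rcases (hu.1 0 0).eq_or_lt with hb | hb
  · rw [eq_zero_of_mem_harmonicCone hu hb.symm]; simp
  rcases (h 0 0).eq_or_lt with hb1 | hb1
  · have := eq_zero_of_mem_harmonicCone hsub (by simp [hb1])
    rw [hb1, hv0, one_smul]
    exact (sub_eq_zero.1 this).symm
  rw [hv0] at hb1
  have hb1' : 0 < 1 - u 0 0 := sub_pos.2 hb1
  -- `v` is the mixture of the normalized `u` and `v - u` with weights `u 0 0` and `1 - u 0 0`.
  have key := hext (x₁ := (u 0 0)⁻¹ • u) ⟨smul_mem_harmonicCone hu (by positivity), by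
      simp [hb.ne']⟩ (x₂ := (1 - u 0 0)⁻¹ • (v - u))
      ⟨smul_mem_harmonicCone hsub (by positivity), by simp [hv0, hb1'.ne']⟩
      ⟨u 0 0, 1 - u 0 0, hb, hb1', by ring, by
        rw [smul_smul, smul_smul, mul_inv_cancel₀ hb.ne', mul_inv_cancel₀ hb1'.ne']; simp⟩
  conv_rhs => rw [← key]
  rw [smul_smul, mul_inv_cancel₀ hb.ne', one_smul]

/-! ### Extreme harmonic functions have a constant ratio -/

/-- Summation over the possible values of the increments number `n, …, n + d - 1`. -/
def pull : ℕ → ℕ → (ℕ → ℝ) → ℕ → ℝ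
  | 0, _, x => x
  | d + 1, n, x => fun k => ∑ j ∈ Finset.range (n + 1), pull d (n + 1) x (k + j)

/-- The available increments depend on the level only, not on `k`, so summation over them commutes
with translation. -/
theorem pull_succ_arg (d n : ℕ) (x : ℕ → ℝ) (k : ℕ) :
    pull d n (fun i => x (i + 1)) k = pull d n x (k + 1) := by
  induction d generalizing n k with
  | zero => rfl
  | succ d ih =>
    simp only [pull, ih]
    exact Finset.sum_congr rfl fun j _ => by rw [add_right_comm]

theorem pull_add (d n : ℕ) (x y : ℕ → ℝ) (k : ℕ) :
    pull d n (fun i => x i + y i) k = pull d n x k + pull d n y k := by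
  induction d generalizing n k with
  | zero => rfl
  | succ d ih => simp only [pull, ih, Finset.sum_add_distrib]

theorem pull_mono (d n : ℕ) {x y : ℕ → ℝ} (h : ∀ k ≤ (n + d).choose 2, x k ≤ y k) (k : ℕ)
    (hk : k ≤ n.choose 2) : pull d n x k ≤ pull d n y k := by
  induction d generalizing n k with
  | zero => exact h k hk
  | succ d ih =>
    refine Finset.sum_le_sum fun j hj => ih (n + 1) (fun i hi => h i ?_) _ ?_
    · rwa [← add_assoc, add_right_comm]
    · rw [choose_succ_two]; rw [Finset.mem_range] at hj; omega

theorem pull_nonneg (d n : ℕ) {x : ℕ → ℝ} (h : ∀ k, 0 ≤ x k) (k : ℕ) : 0 ≤ pull d n x k := by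
  induction d generalizing n k with
  | zero => exact h k
  | succ d ih => exact Finset.sum_nonneg fun j _ => ih _ _

theorem pull_harmonic {v : ℕ → ℕ → ℝ} (hv : v ∈ harmonicCone) (d n k : ℕ)
    (hk : k ≤ n.choose 2) : pull d n (v (n + d)) k = v n k := by
  induction d generalizing n k with
  | zero => rfl
  | succ d ih =>
    rw [hv.2.2 n k hk]
    refine Finset.sum_congr rfl fun j hj => ?_
    rw [← ih (n + 1) (k + j), add_right_comm, add_assoc]
    rw [choose_succ_two]; rw [Finset.mem_range] at hj; omega

/-- A bounded family of functions, eventually harmonic at every vertex, has a harmonic limit along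
an ultrafilter. -/
theorem exists_harmonic_limit {v : ℕ → ℕ → ℝ} (hv : v ∈ harmonicCone) (U : Ultrafilter ℕ)
    (hU : (U : Filter ℕ) ≤ atTop) (F : ℕ → ℕ → ℕ → ℝ)
    (hF : ∀ M n k, n ≤ M → k ≤ n.choose 2 → 0 ≤ F M n k ∧ F M n k ≤ v n k)
    (hh : ∀ M n k, n < M → k ≤ n.choose 2 →
      F M n k = ∑ j ∈ Finset.range (n + 1), F M (n + 1) (k + j)) :
    ∃ u ∈ harmonicCone, (∀ n k, u n k ≤ v n k) ∧
      ∀ n k, k ≤ n.choose 2 → Tendsto (fun M => F M n k) U (𝓝 (u n k)) := by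
  have hlim : ∀ n k, k ≤ n.choose 2 →
      ∃ l, l ∈ Set.Icc 0 (v n k) ∧ Tendsto (fun M => F M n k) U (𝓝 l) := by
    intro n k hk
    obtain ⟨l, hl, hl'⟩ := (isCompact_Icc (a := (0 : ℝ)) (b := v n k)).ultrafilter_le_nhds'
      (U.map fun M => F M n k) (by
        refine hU ?_
        filter_upwards [eventually_ge_atTop n] with M hM using hF M n k hM hk)
    exact ⟨l, hl, hl'⟩
  choose! l hl hl' using hlim
  refine ⟨fun n k => if k ≤ n.choose 2 then l n k else 0, ⟨fun n k => ?_, fun n k hk => ?_,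
    fun n k hk => ?_⟩, fun n k => ?_, fun n k hk => ?_⟩
  · dsimp only
    split_ifs with h
    exacts [(hl n k h).1, le_rfl]
  · simp [hk]
  · have hj : ∀ j ∈ Finset.range (n + 1), k + j ≤ (n + 1).choose 2 := fun j hj => by
      rw [choose_succ_two]; rw [Finset.mem_range] at hj; omega
    dsimp only
    rw [if_pos hk, Finset.sum_congr rfl fun j hj' => if_pos (hj j hj')]
    refine tendsto_nhds_unique (hl' n k hk) ((tendsto_finsetSum _ fun j hj' =>
      hl' (n + 1) (k + j) (hj j hj')).congr' ?_)
    refine hU ?_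
    filter_upwards [eventually_gt_atTop n] with M hM using (hh M n k hM hk).symm
  · dsimp only
    split_ifs with h
    exacts [(hl n k h).2, hv.1 n k]
  · simpa [hk] using hl' n k hk

/-- `a` and `b` are the limiting masses left when the largest, respectively the zero, increment is
forbidden at a late step. -/
theorem exists_ratio_of_extreme {v : ℕ → ℕ → ℝ} (hv : v ∈ Set.extremePoints ℝ weightSet) :
    ∃ a b : ℝ, 0 ≤ a ∧ 0 ≤ b ∧ 0 < a + b ∧
      ∀ n k, k + 1 ≤ n.choose 2 → a * v n (k + 1) = b * v n k := by
  obtain ⟨hvc, hv0⟩ := hv.1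
  -- A single ultrafilter provides limits at all vertices simultaneously.
  set U : Ultrafilter ℕ := hyperfilter ℕ
  have hU : (U : Filter ℕ) ≤ atTop := by
    rw [← Nat.cofinite_eq_atTop]; exact hyperfilter_le_cofinite
  -- The part of `v M k` due to the increments `0, …, M - 1`; the part due to `1, …, M` is `x M (k +
  -- 1)`.
  set x : ℕ → ℕ → ℝ := fun M k => ∑ j ∈ Finset.range M, v (M + 1) (k + j)
  have hx0 : ∀ M k, 0 ≤ x M k := fun M k => Finset.sum_nonneg fun j _ => hvc.1 _ _
  have hxv : ∀ M k, k ≤ M.choose 2 → x M k ≤ v M k := fun M k hk => by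
    rw [hvc.2.2 M k hk]
    exact Finset.sum_le_sum_of_subset_of_nonneg (Finset.range_mono M.le_succ)
      fun j _ _ => hvc.1 _ _
  have hxv' : ∀ M k, k ≤ M.choose 2 → x M (k + 1) ≤ v M k := fun M k hk => by
    rw [hvc.2.2 M k hk, Finset.sum_range_succ']
    refine le_add_of_le_of_nonneg (Finset.sum_le_sum fun j _ => ?_) (hvc.1 _ _)
    rw [add_right_comm, add_assoc]
  -- The only increment missing from `x M k` is `M`, the last term of `x M (k + 1)`; this needs `1 ≤
  -- M`, since `x 0` is an empty sum.
  have hxx : ∀ M k, 1 ≤ M → k ≤ M.choose 2 → v M k ≤ x M k + x M (k + 1) := by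
    intro M k hM hk
    rw [hvc.2.2 M k hk, Finset.sum_range_succ]
    refine add_le_add_right ?_ _
    obtain ⟨m, rfl⟩ : ∃ m, M = m + 1 := ⟨M - 1, by omega⟩
    have := Finset.single_le_sum (s := Finset.range (m + 1))
      (f := fun j => v (m + 1 + 1) (k + 1 + j)) (fun j _ => hvc.1 _ _)
      (Finset.self_mem_range_succ m)
    refine le_trans (le_of_eq ?_) this
    congr 1; omega
  have hM : ∀ {n M : ℕ}, n ≤ M → n + (M - n) = M := fun h => by omega
  have hstep : ∀ (y : ℕ → ℕ → ℝ) (M n k : ℕ), n < M → pull (M - n) n (y M) k =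
      ∑ j ∈ Finset.range (n + 1), pull (M - (n + 1)) (n + 1) (y M) (k + j) := by
    intro y M n k h
    rw [show M - n = M - (n + 1) + 1 by omega]; rfl
  have hdom : ∀ (y : ℕ → ℕ → ℝ) (M n k : ℕ), (∀ k, k ≤ M.choose 2 → y M k ≤ v M k) → n ≤ M →
      k ≤ n.choose 2 → pull (M - n) n (y M) k ≤ v n k := by
    intro y M n k hy h hk
    rw [← pull_harmonic hvc (M - n) n k hk, hM h]
    exact pull_mono _ _ (by rwa [hM h]) _ hk
  obtain ⟨A, hA, hAv, hAl⟩ := exists_harmonic_limit hvc U hU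
    (fun M n k => pull (M - n) n (x M) k)
    (fun M n k h hk => ⟨pull_nonneg _ _ (hx0 M) _, hdom _ _ _ _ (hxv M) h hk⟩)
    (fun M n k h _ => hstep x M n k h)
  obtain ⟨B, hB, hBv, hBl⟩ := exists_harmonic_limit hvc U hU
    (fun M n k => pull (M - n) n (fun i => x M (i + 1)) k)
    (fun M n k h hk => ⟨pull_nonneg _ _ (fun i => hx0 M _) _,
      hdom (fun M i => x M (i + 1)) _ _ _ (hxv' M) h hk⟩)
    (fun M n k h _ => hstep (fun M i => x M (i + 1)) M n k h)
  have hA' := eq_smul_of_le_extreme hv hA hAv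
  have hB' := eq_smul_of_le_extreme hv hB hBv
  refine ⟨A 0 0, B 0 0, hA.1 0 0, hB.1 0 0, ?_, fun n k hk => ?_⟩
  · refine lt_of_lt_of_le one_pos (ge_of_tendsto ((hAl 0 0 (by simp)).add (hBl 0 0 (by simp))) ?_)
    refine hU ?_
    filter_upwards [eventually_ge_atTop 1] with M h1
    rw [← pull_add, ← hv0, ← pull_harmonic hvc (M - 0) 0 0 (by simp), hM (Nat.zero_le M)]
    exact pull_mono _ _ (fun k hk => hxx M k h1 (by rwa [hM (Nat.zero_le M)] at hk)) _ (by simp)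
  · have h1 : A n (k + 1) = A 0 0 * v n (k + 1) := congrFun (congrFun hA' n) (k + 1)
    have h2 : B n k = B 0 0 * v n k := congrFun (congrFun hB' n) k
    rw [← h1, ← h2]
    refine tendsto_nhds_unique (hAl n (k + 1) hk) ((hBl n k (by omega)).congr fun M => ?_)
    exact pull_succ_arg _ _ _ _

/-! ### Geometric weights -/

/-- The harmonic function of the Mallows law with `q = b / a`. -/
noncomputable def ratioWeight (a b : ℝ) (n k : ℕ) : ℝ :=
  if k ≤ n.choose 2 then a ^ (n.choose 2 - k) * b ^ k /
    ∏ m ∈ Finset.range n, ∑ j ∈ Finset.range (m + 1), a ^ (m - j) * b ^ j else 0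

theorem homogeneous_sum_pos {a b : ℝ} (ha : 0 ≤ a) (hb : 0 ≤ b) (hab : 0 < a + b) (m : ℕ) :
    0 < ∑ j ∈ Finset.range (m + 1), a ^ (m - j) * b ^ j := by
  refine Finset.sum_pos' (fun j _ => by positivity) ?_
  rcases ha.eq_or_lt with rfl | ha
  · exact ⟨m, by simp, by have : 0 < b := by linarith
                          simp; positivity⟩
  · exact ⟨0, by simp, by simp; positivity⟩

theorem homogeneous_mul_sum (a b : ℝ) {n k : ℕ} (hk : k ≤ n.choose 2) :
    ∑ j ∈ Finset.range (n + 1), a ^ ((n + 1).choose 2 - (k + j)) * b ^ (k + j) =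
      a ^ (n.choose 2 - k) * b ^ k * ∑ j ∈ Finset.range (n + 1), a ^ (n - j) * b ^ j := by
  rw [Finset.mul_sum]
  refine Finset.sum_congr rfl fun j hj => ?_
  rw [Finset.mem_range] at hj
  rw [choose_succ_two, show n.choose 2 + n - (k + j) = (n.choose 2 - k) + (n - j) by omega,
    pow_add, pow_add]
  ring

theorem ratioWeight_mem_weightSet {a b : ℝ} (ha : 0 ≤ a) (hb : 0 ≤ b) (hab : 0 < a + b) :
    ratioWeight a b ∈ weightSet := by
  have hs := homogeneous_sum_pos ha hb hab
  have hp : ∀ n, 0 < ∏ m ∈ Finset.range n, ∑ j ∈ Finset.range (m + 1), a ^ (m - j) * b ^ j :=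
    fun n => Finset.prod_pos fun m _ => hs m
  refine ⟨⟨fun n k => ?_, fun n k hk => ?_, fun n k hk => ?_⟩, by simp [ratioWeight]⟩
  · unfold ratioWeight
    split_ifs
    · have := hp n
      positivity
    · exact le_rfl
  · simp [ratioWeight, hk]
  · have hj : ∀ j ∈ Finset.range (n + 1), k + j ≤ (n + 1).choose 2 := fun j hj => by
      rw [choose_succ_two]; rw [Finset.mem_range] at hj; omega
    unfold ratioWeight
    rw [if_pos hk, Finset.sum_congr rfl fun j hj' => if_pos (hj j hj'), ← Finset.sum_div,
      homogeneous_mul_sum a b hk, Finset.prod_range_succ, mul_div_mul_right _ _ (hs n).ne']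

/-- The ratio fixes each level up to a constant `c n`, and harmonicity at one vertex of nonzero
weight gives the recursion for `c`. -/
theorem eq_ratioWeight {v : ℕ → ℕ → ℝ} (hv : v ∈ weightSet) {a b : ℝ} (ha : 0 ≤ a) (hb : 0 ≤ b)
    (hab : 0 < a + b) (h : ∀ n k, k + 1 ≤ n.choose 2 → a * v n (k + 1) = b * v n k) :
    v = ratioWeight a b := by
  have hs := homogeneous_sum_pos ha hb hab
  obtain ⟨hvc, hv0⟩ := hv
  have hc : ∀ n, ∃ c, ∀ k, k ≤ n.choose 2 → v n k = c * (a ^ (n.choose 2 - k) * b ^ k) := by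
    intro n
    -- If `a = 0`, all mass of the level sits at the maximal inversion count, so the constant is
    -- read off there rather than at `k = 0`.
    rcases ha.eq_or_lt with rfl | ha
    · have hb : 0 < b := by linarith
      refine ⟨v n (n.choose 2) / b ^ n.choose 2, fun k hk => ?_⟩
      rcases hk.eq_or_lt with rfl | hk
      · simp [hb.ne']
      · have := h n k hk
        rw [zero_mul, eq_comm, mul_eq_zero, or_iff_right hb.ne'] at this
        rw [this, zero_pow (by omega)]; simp
    · refine ⟨v n 0 / a ^ n.choose 2, fun k => ?_⟩
      induction k with
      | zero => intro; simp [ha.ne']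
      | succ k ih =>
        intro hk
        have h1 := h n k hk
        rw [ih (by omega), show n.choose 2 - k = n.choose 2 - (k + 1) + 1 by omega] at h1
        apply mul_left_cancel₀ ha.ne'
        rw [h1]; ring
  choose c hc using hc
  have hcn : ∀ n, c n = (∏ m ∈ Finset.range n,
      ∑ j ∈ Finset.range (m + 1), a ^ (m - j) * b ^ j)⁻¹ := by
    intro n
    induction n with
    | zero => have := hc 0 0 (by simp); simpa [hv0, eq_comm] using this
    | succ n ih =>
      have hj : ∀ {k}, k ≤ n.choose 2 → ∀ j ∈ Finset.range (n + 1), k + j ≤ (n + 1).choose 2 :=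
        fun hk j hj => by rw [choose_succ_two]; rw [Finset.mem_range] at hj; omega
      obtain ⟨k, hk, hne⟩ : ∃ k ≤ n.choose 2, a ^ (n.choose 2 - k) * b ^ k ≠ 0 := by
        rcases ha.eq_or_lt with rfl | ha
        · have hb : 0 < b := by linarith
          exact ⟨_, le_rfl, by simp [hb.ne']⟩
        · exact ⟨0, Nat.zero_le _, by simp [ha.ne']⟩
      have h1 := hvc.2.2 n k hk
      rw [hc n k hk, Finset.sum_congr rfl fun j hj' => hc (n + 1) (k + j) (hj hk j hj'),
        ← Finset.mul_sum, homogeneous_mul_sum a b hk] at h1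
      rw [Finset.prod_range_succ, mul_inv, ← ih]
      have h2 : c n = c (n + 1) * ∑ j ∈ Finset.range (n + 1), a ^ (n - j) * b ^ j := by
        apply mul_right_cancel₀ hne
        rw [h1]; ring
      rw [h2, mul_assoc, mul_inv_cancel₀ (hs n).ne', mul_one]
  funext n k
  unfold ratioWeight
  split_ifs with hk
  · rw [hc n k hk, hcn, div_eq_mul_inv, mul_comm]
  · exact hvc.2.1 n k (not_le.1 hk)

theorem ratioWeight_ratio (a b : ℝ) (n k : ℕ) (hk : k + 1 ≤ n.choose 2) :
    a * ratioWeight a b n (k + 1) = b * ratioWeight a b n k := by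
  unfold ratioWeight
  rw [if_pos hk, if_pos (by omega), show n.choose 2 - k = n.choose 2 - (k + 1) + 1 by omega]
  ring

/-! ### Geometric weights are exposed points -/

/-- Evaluation of functions at a vertex, as a continuous linear form. -/
noncomputable def evalForm (n k : ℕ) : StrongDual ℝ (ℕ → ℕ → ℝ) :=
  (ContinuousLinearMap.proj k : StrongDual ℝ (ℕ → ℝ)).comp
    (ContinuousLinearMap.proj n : (ℕ → ℕ → ℝ) →L[ℝ] ℕ → ℝ)

/-- The linear form that exposes `ratioWeight a b` as the only point of `weightSet` at which it
vanishes: a combination of the probabilities of the values `0`, `1`, `2` of the third increment. -/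
noncomputable def exposingForm (a b : ℝ) : StrongDual ℝ (ℕ → ℕ → ℝ) :=
  b ^ 2 • (evalForm 3 0 + evalForm 3 1) - (2 * a * b) • (evalForm 3 1 + evalForm 3 2) +
    a ^ 2 • (evalForm 3 2 + evalForm 3 3)

/-- The third increment takes the values `0, 1, 2` with probabilities proportional to `c ^ 2, c * d,
d ^ 2`, which makes the form a perfect square. -/
theorem exposingForm_ratioWeight (a b : ℝ) {c d : ℝ} (hc : 0 ≤ c) (hd : 0 ≤ d)
    (hcd : 0 < c + d) : exposingForm a b (ratioWeight c d) =
      (b * c - a * d) ^ 2 / (c ^ 2 + c * d + d ^ 2) := by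
  have h2 : 0 < c ^ 2 + c * d + d ^ 2 := by
    have := homogeneous_sum_pos hc hd hcd 2
    simpa [Finset.sum_range_succ] using this
  simp [exposingForm, evalForm, ratioWeight, Finset.prod_range_succ, Finset.sum_range_succ]
  field_simp
  ring

theorem extremePoints_weightSet_eq_ratioWeight {v : ℕ → ℕ → ℝ}
    (hv : v ∈ Set.extremePoints ℝ weightSet) :
    ∃ a b : ℝ, 0 ≤ a ∧ 0 ≤ b ∧ 0 < a + b ∧ v = ratioWeight a b := by
  obtain ⟨a, b, ha, hb, hab, h⟩ := exists_ratio_of_extreme hv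
  exact ⟨a, b, ha, hb, hab, eq_ratioWeight hv.1 ha hb hab h⟩

theorem ratioWeight_mem_extremePoints {a b : ℝ} (ha : 0 ≤ a) (hb : 0 ≤ b) (hab : 0 < a + b) :
    ratioWeight a b ∈ Set.extremePoints ℝ weightSet := by
  set l := exposingForm a b
  have hmem := ratioWeight_mem_weightSet ha hb hab
  have hl0 : l (ratioWeight a b) = 0 := by
    rw [exposingForm_ratioWeight a b ha hb hab]; simp [mul_comm a b]
  -- The face where `l` is minimal. Its extreme points are extreme in `weightSet`, so they are
  -- geometric, and there `l ≤ 0` forces the ratio `b / a`.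
  set E : Set (ℕ → ℕ → ℝ) := {y ∈ weightSet | ∀ z ∈ weightSet, (-l) z ≤ (-l) y} with hE
  have hexp : IsExposed ℝ weightSet E := fun _ => ⟨-l, rfl⟩
  have hEc : IsCompact E := hexp.isCompact isCompact_weightSet
  have hEconv : Convex ℝ E := hexp.convex convex_weightSet
  have hext : ∀ y ∈ Set.extremePoints ℝ E, y = ratioWeight a b := by
    intro y hy
    obtain ⟨c, d, hc, hd, hcd, rfl⟩ := extremePoints_weightSet_eq_ratioWeight
      (hexp.isExtreme.extremePoints_subset_extremePoints hy)
    have h1 : l (ratioWeight c d) ≤ 0 := by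
      have := hy.1.2 _ hmem
      simp only [neg_apply, hl0] at this
      linarith
    have h2 : 0 < c ^ 2 + c * d + d ^ 2 := by
      have := homogeneous_sum_pos hc hd hcd 2
      simpa [Finset.sum_range_succ] using this
    rw [exposingForm_ratioWeight a b hc hd hcd, div_nonpos_iff] at h1
    have h3 : (b * c - a * d) ^ 2 = 0 := by
      rcases h1 with h1 | h1
      · linarith [h1.2]
      · exact le_antisymm h1.1 (sq_nonneg _)
    have h4 : b * c = a * d := sub_eq_zero.1 (pow_eq_zero_iff two_ne_zero |>.1 h3)
    refine eq_ratioWeight hy.1.1 ha hb hab fun n k hk => ?_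
    have h5 := ratioWeight_ratio c d n k hk
    rcases hc.eq_or_lt with rfl | hc
    · have hd' : d ≠ 0 := by linarith
      have ha0 : a = 0 := by simpa [hd'] using h4
      have : ratioWeight 0 d n k = 0 := by simpa [hd'] using h5.symm
      rw [ha0, this]; simp
    · apply mul_left_cancel₀ hc.ne'
      linear_combination a * h5 - ratioWeight c d n k * h4
  -- Krein–Milman: a compact convex set with at most one extreme point has at most one point.
  have hEs : E ⊆ {ratioWeight a b} := by
    rw [← closure_convexHull_extremePoints hEc hEconv]
    refine closure_minimal (convexHull_min hext (convex_singleton _)) isClosed_singleton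
  -- The minimum is attained, hence attained at `ratioWeight a b`, where `l` vanishes.
  have hmin : ∀ z ∈ weightSet, 0 ≤ l z := by
    obtain ⟨y, hy, hy'⟩ := isCompact_weightSet.exists_isMaxOn ⟨_, hmem⟩ (-l).continuous.continuousOn
    have hyE : y ∈ E := ⟨hy, fun z hz => hy' hz⟩
    intro z hz
    have := hyE.2 z hz
    rw [hEs hyE] at this
    simpa [hl0] using this
  refine ⟨hmem, fun x hx y hy hxy => hEs ⟨hx, fun z hz => ?_⟩⟩
  obtain ⟨s, t, hs, ht, -, hst⟩ := hxy
  have h1 : s * l x + t * l y = 0 := by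
    rw [← hl0, ← hst]; simp
  have h2 : l x ≤ 0 := by
    by_contra! h
    have := mul_pos hs h
    have := mul_nonneg ht.le (hmin y hy)
    linarith
  simp only [neg_apply]
  linarith [hmin z hz]

/-! ### Inversions and the last entry -/

theorem succAbove_proj {n : ℕ} (σ : Equiv.Perm (Fin (n + 1))) (i : Fin n) :
    (σ (Fin.last n)).succAbove (proj σ i) = σ i.castSucc := by
  have h : ((finSuccAboveEquiv (σ (Fin.last n))) (proj σ i) : Fin (n + 1)) =
      σ ((Fin.last n).succAbove i) := by
    simp only [proj, Equiv.trans_apply]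
    exact congrArg Subtype.val (Equiv.apply_symm_apply _ _)
  rw [← Fin.succAbove_last_apply, ← h]; rfl

/-- A permutation of `n + 1` letters amounts to its projection together with its last entry. -/
noncomputable def projEquiv (n : ℕ) :
    Equiv.Perm (Fin (n + 1)) ≃ Equiv.Perm (Fin n) × Fin (n + 1) :=
  Equiv.ofBijective (fun σ => (proj σ, σ (Fin.last n))) <| by
    rw [Fintype.bijective_iff_injective_and_card]
    refine ⟨fun σ τ h => ?_, ?_⟩
    · simp only [Prod.mk.injEq] at h
      ext i : 1
      induction i using Fin.lastCases with
      | last => exact h.2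
      | cast i => rw [← succAbove_proj, ← succAbove_proj, h.1, h.2]
    · simp [Fintype.card_perm, Nat.factorial_succ, mul_comm]

/-- Relabelling preserves relative order, and the last entry is inverted with precisely the `n - σ
(Fin.last n)` larger values (values start at `0`). -/
theorem inversions_eq_add {n : ℕ} (σ : Equiv.Perm (Fin (n + 1))) :
    inversions σ = inversions (proj σ) + (n - σ (Fin.last n)) := by
  have hs : ∀ {m : ℕ} (π : Equiv.Perm (Fin m)),
      inversions π = ∑ i, ∑ j, if i < j ∧ π j < π i then 1 else 0 := by
    intro m π
    rw [inversions, Finset.card_filter, Fintype.sum_prod_type]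
  have hlast : ∀ j, ¬ Fin.last n < j := fun j => not_lt.2 (Fin.le_last j)
  have hcount : ∑ i : Fin n, (if σ (Fin.last n) < σ i.castSucc then 1 else 0) =
      n - σ (Fin.last n) := by
    have h1 : ∑ i : Fin (n + 1), (if σ (Fin.last n) < σ i then 1 else 0) =
        n - σ (Fin.last n) := by
      rw [Equiv.sum_comp σ fun y => if σ (Fin.last n) < y then 1 else 0, ← Finset.card_filter]
      have : Finset.univ.filter (fun y => σ (Fin.last n) < y) = Finset.Ioi (σ (Fin.last n)) := by
        ext y; simp
      rw [this, Fin.card_Ioi]; omega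
    rw [Fin.sum_univ_castSucc] at h1
    simpa using h1
  simp only [← succAbove_proj] at hcount
  rw [hs, hs, Fin.sum_univ_castSucc]
  simp only [Fin.sum_univ_castSucc, hlast, false_and, if_false, Finset.sum_const_zero, add_zero,
    Fin.castSucc_lt_last, true_and, Finset.sum_add_distrib, hcount, Fin.castSucc_lt_castSucc_iff,
    ← succAbove_proj, (Fin.strictMono_succAbove _).lt_iff_lt]

theorem inversions_le {n : ℕ} (π : Equiv.Perm (Fin n)) : inversions π ≤ n.choose 2 := by
  induction n with
  | zero => simp [inversions]
  | succ n ih => rw [inversions_eq_add, choose_succ_two]; have := ih (proj π); omega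

theorem inversions_projEquiv_symm {n : ℕ} (π : Equiv.Perm (Fin n)) (x : Fin (n + 1)) :
    inversions ((projEquiv n).symm (π, x)) = inversions π + (n - x) := by
  have h := (projEquiv n).apply_symm_apply (π, x)
  have h1 : proj ((projEquiv n).symm (π, x)) = π := congrArg Prod.fst h
  have h2 : (projEquiv n).symm (π, x) (Fin.last n) = x := congrArg Prod.snd h
  rw [inversions_eq_add, h1, h2]

theorem proj_projEquiv_symm {n : ℕ} (π : Equiv.Perm (Fin n)) (x : Fin (n + 1)) :
    proj ((projEquiv n).symm (π, x)) = π :=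
  congrArg Prod.fst ((projEquiv n).apply_symm_apply (π, x))

theorem sum_proj_eq {M : Type*} [AddCommMonoid M] {n : ℕ} (π : Equiv.Perm (Fin n))
    (f : Equiv.Perm (Fin (n + 1)) → M) :
    ∑ σ with proj σ = π, f σ = ∑ x : Fin (n + 1), f ((projEquiv n).symm (π, x)) := by
  symm
  refine Finset.sum_bij (fun x _ => (projEquiv n).symm (π, x)) (fun x _ => ?_)
    (fun x _ y _ h => ?_) (fun σ hσ => ⟨σ (Fin.last n), Finset.mem_univ _, ?_⟩) fun _ _ => rfl
  · simp [proj_projEquiv_symm]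
  · simpa using h
  · rw [Finset.mem_filter] at hσ
    rw [Equiv.symm_apply_eq]
    exact Prod.ext hσ.2.symm rfl

theorem sum_proj_inversions {M : Type*} [AddCommMonoid M] {n : ℕ} (π : Equiv.Perm (Fin n))
    (f : ℕ → M) : ∑ σ with proj σ = π, f (inversions σ) =
      ∑ j ∈ Finset.range (n + 1), f (inversions π + j) := by
  rw [sum_proj_eq]
  simp only [inversions_projEquiv_symm]
  rw [Fin.sum_univ_eq_sum_range (fun x => f (inversions π + (n - x))),
    ← Finset.sum_range_reflect]
  refine Finset.sum_congr rfl fun j hj => ?_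
  rw [Finset.mem_range] at hj
  congr 2; omega

theorem exists_inversions_eq {n k : ℕ} (hk : k ≤ n.choose 2) :
    ∃ π : Equiv.Perm (Fin n), inversions π = k := by
  induction n generalizing k with
  | zero => exact ⟨1, by simp [inversions] at hk ⊢; omega⟩
  | succ n ih =>
    rw [choose_succ_two] at hk
    obtain ⟨π, hπ⟩ := ih (min_le_right k (n.choose 2))
    -- The first `n` letters supply as many inversions as possible; the last entry supplies the
    -- remainder, at most `n`.
    refine ⟨(projEquiv n).symm (π, ⟨n - (k - min k (n.choose 2)), by omega⟩), ?_⟩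
    rw [inversions_projEquiv_symm, hπ]
    simp only
    omega

theorem inversions_eq_choose_iff {n : ℕ} (π : Equiv.Perm (Fin n)) :
    inversions π = n.choose 2 ↔ π = Fin.revPerm := by
  have hrev : ∀ n, inversions (Fin.revPerm : Equiv.Perm (Fin n)) = n.choose 2 ∧
      proj (Fin.revPerm : Equiv.Perm (Fin (n + 1))) = Fin.revPerm := by
    intro n
    have hp : ∀ n, proj (Fin.revPerm : Equiv.Perm (Fin (n + 1))) = Fin.revPerm := by
      intro n
      ext i : 1
      apply Fin.succAbove_right_injective (p := (Fin.revPerm : Equiv.Perm (Fin (n + 1))) (Fin.last n))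
      rw [succAbove_proj]
      simp [Fin.rev_castSucc]
    refine ⟨?_, hp n⟩
    induction n with
    | zero => simp [inversions]
    | succ n ih => rw [inversions_eq_add, hp, ih, choose_succ_two]; simp
  refine ⟨fun h => ?_, fun h => h ▸ (hrev n).1⟩
  induction n with
  | zero => exact Subsingleton.elim _ _
  | succ n ih =>
    rw [inversions_eq_add, choose_succ_two] at h
    have h1 := inversions_le (proj π)
    have h2 := ih (proj π) (by omega)
    apply (projEquiv n).injective
    refine Prod.ext (h2.trans (hrev n).2.symm) ?_
    change π (Fin.last n) = Fin.rev (Fin.last n)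
    have := inversions_le (proj π)
    have := (π (Fin.last n)).is_le
    rw [Fin.ext_iff, Fin.rev_last, Fin.val_zero]
    omega

/-! ### Virtual permutations and their finite-dimensional laws -/

/-- Every permutation of `n` letters extends to a virtual permutation. -/
theorem exists_virtualPerm {n : ℕ} (π : Equiv.Perm (Fin n)) :
    ∃ ω : VirtualPerm, ω.1 n = π := by
  let V : ((n : ℕ) → Fin (n + 1)) → (n : ℕ) → Equiv.Perm (Fin n) := fun r n =>
    Nat.rec (motive := fun n => Equiv.Perm (Fin n)) 1 (fun n π => (projEquiv n).symm (π, r n)) n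
  have hV : ∀ r n, proj (V r (n + 1)) = V r n := fun r n => proj_projEquiv_symm _ _
  suffices h : ∃ r, V r n = π by
    obtain ⟨r, hr⟩ := h
    exact ⟨⟨V r, hV r⟩, hr⟩
  induction n with
  | zero => exact ⟨fun _ => 0, Subsingleton.elim _ _⟩
  | succ n ih =>
    obtain ⟨r, hr⟩ := ih (proj π)
    refine ⟨Function.update r n (π (Fin.last n)), ?_⟩
    -- Level `m` uses only `r i` with `i < m`, so changing `r n` leaves levels up to `n` intact.
    have hagree : ∀ m ≤ n, V (Function.update r n (π (Fin.last n))) m = V r m := by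
      intro m
      induction m with
      | zero => intro; rfl
      | succ m ihm =>
        intro hm
        change (projEquiv m).symm (V _ m, _) = (projEquiv m).symm (V r m, r m)
        rw [ihm (by omega), Function.update_of_ne (by omega)]
    change (projEquiv n).symm (V _ n, _) = π
    rw [hagree n le_rfl, hr, Function.update_self, Equiv.symm_apply_eq]
    rfl

theorem measurableSet_coord {n : ℕ} (T : Set (Equiv.Perm (Fin n))) :
    MeasurableSet {ω : VirtualPerm | ω.1 n ∈ T} :=
  ((measurable_pi_apply n).comp measurable_subtype_coe) (show MeasurableSet T from trivial)

theorem measurableSet_coord_eq {n : ℕ} (π : Equiv.Perm (Fin n)) :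
    MeasurableSet {ω : VirtualPerm | ω.1 n = π} :=
  measurableSet_coord {π}

theorem measure_coord_mem (μ : Measure VirtualPerm) {n : ℕ} (T : Set (Equiv.Perm (Fin n)))
    [DecidablePred (· ∈ T)] :
    μ {ω | ω.1 n ∈ T} = ∑ π with π ∈ T, μ {ω | ω.1 n = π} := by
  rw [← measure_biUnion_finset (f := fun π => {ω : VirtualPerm | ω.1 n = π})
    (fun π _ σ _ h => Set.disjoint_left.2 fun ω h1 h2 => h (Eq.trans (Eq.symm h1) h2))
    fun π _ => measurableSet_coord_eq π]
  congr 1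
  ext ω
  simp

theorem measure_coord_eq_sum (μ : Measure VirtualPerm) {n : ℕ} (π : Equiv.Perm (Fin n)) :
    μ {ω | ω.1 n = π} = ∑ σ with proj σ = π, μ {ω | ω.1 (n + 1) = σ} := by
  refine Eq.trans (congrArg μ ?_) (measure_coord_mem μ {σ | proj σ = π})
  ext ω
  simp [ω.2 n]

theorem measureReal_coord_eq_sum (μ : Measure VirtualPerm) [IsFiniteMeasure μ] {n : ℕ}
    (π : Equiv.Perm (Fin n)) :
    μ.real {ω | ω.1 n = π} = ∑ σ with proj σ = π, μ.real {ω | ω.1 (n + 1) = σ} := by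
  simp only [Measure.real]
  rw [measure_coord_eq_sum, ENNReal.toReal_sum fun _ _ => measure_ne_top _ _]

theorem exists_coord_factor {m n : ℕ} (h : m ≤ n) :
    ∃ f : Equiv.Perm (Fin n) → Equiv.Perm (Fin m), ∀ ω : VirtualPerm, ω.1 m = f (ω.1 n) := by
  induction n, h using Nat.le_induction with
  | base => exact ⟨id, fun _ => rfl⟩
  | succ n _ ih =>
    obtain ⟨f, hf⟩ := ih
    exact ⟨fun σ => f (proj σ), fun ω => by rw [hf ω, ← ω.2 n]⟩

/-- A probability law on virtual permutations is determined by the laws of its coordinates. -/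
theorem measure_ext {μ ν : Measure VirtualPerm} [IsProbabilityMeasure μ] [IsProbabilityMeasure ν]
    (h : ∀ (n : ℕ) (π : Equiv.Perm (Fin n)), μ {ω | ω.1 n = π} = ν {ω | ω.1 n = π}) : μ = ν := by
  classical
  refine ext_of_generate_finite
    {s | ∃ (n : ℕ) (T : Set (Equiv.Perm (Fin n))), s = {ω : VirtualPerm | ω.1 n ∈ T}} ?_ ?_ ?_
    (by simp)
  · apply le_antisymm
    · rw [Subtype.instMeasurableSpace, MeasurableSpace.pi, MeasurableSpace.comap_iSup]
      refine iSup_le fun n => ?_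
      rw [MeasurableSpace.comap_comp]
      rintro _ ⟨T, -, rfl⟩
      exact MeasurableSpace.measurableSet_generateFrom ⟨n, T, rfl⟩
    · refine MeasurableSpace.generateFrom_le ?_
      rintro _ ⟨n, T, rfl⟩
      exact measurableSet_coord T
  -- Of two levels the higher determines the lower, so cylinders form a π-system.
  · rintro _ ⟨m, S, rfl⟩ _ ⟨n, T, rfl⟩ -
    rcases le_total m n with hmn | hmn
    · obtain ⟨f, hf⟩ := exists_coord_factor hmn
      exact ⟨n, f ⁻¹' S ∩ T, by ext ω; simp [hf ω]⟩
    · obtain ⟨f, hf⟩ := exists_coord_factor hmn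
      exact ⟨m, S ∩ f ⁻¹' T, by ext ω; simp [hf ω]⟩
  · rintro _ ⟨n, T, rfl⟩
    simp only [measure_coord_mem, h]

/-! ### Laws and their weights -/

/-- `μ` is a probability law under which the mass of a permutation is given by `v`. -/
def HasWeight (μ : Measure VirtualPerm) (v : ℕ → ℕ → ℝ) : Prop :=
  IsProbabilityMeasure μ ∧
    ∀ (n : ℕ) (π : Equiv.Perm (Fin n)), μ.real {ω | ω.1 n = π} = v n (inversions π)

theorem HasWeight.mem_issLaws {μ : Measure VirtualPerm} {v : ℕ → ℕ → ℝ} (h : HasWeight μ v) :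
    μ ∈ issLaws := by
  have := h.1
  refine ⟨h.1, fun n π σ hd => ?_⟩
  rw [dist_one_eq_inversions, dist_one_eq_inversions] at hd
  rw [← measureReal_eq_measureReal_iff, h.2, h.2, hd]

theorem HasWeight.measure_eq {μ ν : Measure VirtualPerm} {v : ℕ → ℕ → ℝ} (h : HasWeight μ v)
    (h' : HasWeight ν v) : μ = ν := by
  have := h.1
  have := h'.1
  refine measure_ext fun n π => ?_
  rw [← measureReal_eq_measureReal_iff, h.2, h'.2]

theorem HasWeight.weight_eq {μ : Measure VirtualPerm} {v w : ℕ → ℕ → ℝ} (h : HasWeight μ v)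
    (h' : HasWeight μ w) (hv : v ∈ weightSet) (hw : w ∈ weightSet) : v = w := by
  funext n k
  rcases le_or_gt k (n.choose 2) with hk | hk
  · obtain ⟨π, rfl⟩ := exists_inversions_eq hk
    rw [← h.2, h'.2]
  · rw [hv.1.2.1 n k hk, hw.1.2.1 n k hk]

theorem exists_weight_of_mem_issLaws {μ : Measure VirtualPerm} (h : μ ∈ issLaws) :
    ∃ v ∈ weightSet, HasWeight μ v := by
  obtain ⟨hp, hi⟩ := h
  have hex : ∀ n k, k ≤ n.choose 2 → ∃ π : Equiv.Perm (Fin n), inversions π = k :=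
    fun n k hk => exists_inversions_eq hk
  choose! P hP using hex
  set v : ℕ → ℕ → ℝ := fun n k => if k ≤ n.choose 2 then μ.real {ω | ω.1 n = P n k} else 0
    with hv
  have hw : ∀ (n : ℕ) (π : Equiv.Perm (Fin n)), μ.real {ω | ω.1 n = π} = v n (inversions π) := by
    intro n π
    simp only [hv]
    rw [if_pos (inversions_le π), Measure.real, Measure.real]
    congr 1
    apply hi
    rw [dist_one_eq_inversions, dist_one_eq_inversions, hP _ _ (inversions_le π)]
  refine ⟨v, ⟨⟨fun n k => ?_, fun n k hk => ?_, fun n k hk => ?_⟩, ?_⟩, hp, hw⟩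
  · simp only [hv]
    split_ifs
    exacts [measureReal_nonneg, le_rfl]
  · simp [hv, hk]
  · obtain ⟨π, rfl⟩ := exists_inversions_eq hk
    rw [← hw, measureReal_coord_eq_sum]
    simp only [hw]
    rw [sum_proj_inversions π fun k => v (n + 1) k]
  · have h0 : inversions (1 : Equiv.Perm (Fin 0)) = 0 := by simp [inversions]
    have h1 : {ω : VirtualPerm | ω.1 0 = 1} = Set.univ :=
      Set.eq_univ_of_forall fun ω => Subsingleton.elim _ _
    have h2 := hw 0 1
    rw [h1, probReal_univ, h0] at h2
    exact h2.symm

/-- The discrete topology on the finite set of permutations. -/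
instance permTopologicalSpace (n : ℕ) : TopologicalSpace (Equiv.Perm (Fin n)) := ⊥

instance permDiscreteTopology (n : ℕ) : DiscreteTopology (Equiv.Perm (Fin n)) := ⟨rfl⟩

instance permSecondCountableTopology (n : ℕ) : SecondCountableTopology (Equiv.Perm (Fin n)) :=
  DiscreteTopology.secondCountableTopology_of_countable

instance permBorelSpace (n : ℕ) : BorelSpace (Equiv.Perm (Fin n)) :=
  ⟨borel_eq_top_of_discrete.symm⟩

theorem isClopen_coord_eq {n : ℕ} (π : Equiv.Perm (Fin n)) :
    IsClopen {ω : VirtualPerm | ω.1 n = π} :=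
  (isClopen_discrete {π}).preimage ((continuous_apply n).comp continuous_subtype_val)

instance virtualPermCompactSpace : CompactSpace VirtualPerm := by
  have h : IsClosed (⋂ n, {ω : (n : ℕ) → Equiv.Perm (Fin n) | proj (ω (n + 1)) = ω n}) :=
    isClosed_iInter fun n => isClosed_eq
      ((continuous_of_discreteTopology (f := proj)).comp (continuous_apply (n + 1))) (continuous_apply n)
  have h' : IsClosed {ω : (n : ℕ) → Equiv.Perm (Fin n) | ∀ n, proj (ω (n + 1)) = ω n} := by
    convert h using 1
    ext
    simp
  exact isCompact_iff_compactSpace.1 h'.isCompact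

instance virtualPermHasOuterApproxClosed : HasOuterApproxClosed VirtualPerm :=
  haveI : SecondCountableTopology VirtualPerm :=
    Topology.IsEmbedding.subtypeVal.secondCountableTopology
  haveI := TopologicalSpace.metrizableSpace_of_t3_secondCountable VirtualPerm
  letI := TopologicalSpace.metrizableSpaceMetric VirtualPerm
  inferInstance

/-- Compactness replaces an extension theorem: a limit of discrete laws that are correct up to level
`N` is correct at every level. -/
theorem exists_hasWeight {v : ℕ → ℕ → ℝ} (hv : v ∈ weightSet) : ∃ μ, HasWeight μ v := by
  classical
  obtain ⟨⟨h0, -, hh⟩, hv0⟩ := hv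
  choose E hE using fun (n : ℕ) (π : Equiv.Perm (Fin n)) => exists_virtualPerm π
  -- Each permutation of `N` letters is extended arbitrarily; harmonicity makes the masses correct
  -- at all levels `n ≤ N`.
  let m : ℕ → Measure VirtualPerm := fun N =>
    ∑ π : Equiv.Perm (Fin N), ENNReal.ofReal (v N (inversions π)) • Measure.dirac (E N π)
  have hm : ∀ d n N (π : Equiv.Perm (Fin n)), n + d = N →
      m N {ω | ω.1 n = π} = ENNReal.ofReal (v n (inversions π)) := by
    intro d
    induction d with
    | zero =>
      rintro n _ π rfl
      change m n _ = _
      simp only [m, Measure.finsetSum_apply, Measure.smul_apply, smul_eq_mul,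
        Measure.dirac_apply' _ (measurableSet_coord_eq π)]
      rw [Finset.sum_eq_single π]
      · simp [hE]
      · intro σ _ hσ
        simp [hE, hσ]
      · simp
    | succ d ih =>
      intro n N π hN
      rw [measure_coord_eq_sum, Finset.sum_congr rfl fun σ _ => ih (n + 1) N σ (by omega),
        sum_proj_inversions π fun k => ENNReal.ofReal (v (n + 1) k), hh n _ (inversions_le π),
        ENNReal.ofReal_sum_of_nonneg fun j _ => h0 _ _]
  have hp : ∀ N, IsProbabilityMeasure (m N) := by
    intro N
    have h0 : inversions (1 : Equiv.Perm (Fin 0)) = 0 := by simp [inversions]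
    have h1 : {ω : VirtualPerm | ω.1 0 = 1} = Set.univ :=
      Set.eq_univ_of_forall fun ω => Subsingleton.elim _ _
    exact ⟨by rw [← h1, hm N 0 N 1 (zero_add N), h0, hv0, ENNReal.ofReal_one]⟩
  let Q : ℕ → ProbabilityMeasure VirtualPerm := fun N => ⟨m N, hp N⟩
  obtain ⟨μ, -, hμ⟩ := isCompact_univ.ultrafilter_le_nhds' ((hyperfilter ℕ).map Q)
    Filter.univ_mem
  refine ⟨μ, inferInstance, fun n π => ?_⟩
  have h1 : Tendsto (fun N => (Q N : Measure VirtualPerm) {ω | ω.1 n = π}) (hyperfilter ℕ)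
      (𝓝 ((μ : Measure VirtualPerm) {ω | ω.1 n = π})) :=
    -- Portmanteau applies because cylinders are clopen and so have empty frontier.
    ProbabilityMeasure.tendsto_measure_of_null_frontier_of_tendsto' hμ
      (by rw [(isClopen_coord_eq π).frontier_eq, measure_empty])
  have h2 : (μ : Measure VirtualPerm) {ω | ω.1 n = π} = ENNReal.ofReal (v n (inversions π)) := by
    refine tendsto_nhds_unique h1 (tendsto_const_nhds.congr' ?_)
    refine hyperfilter_le_cofinite ?_
    rw [Nat.cofinite_eq_atTop]
    filter_upwards [eventually_ge_atTop n] with N hN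
    exact (hm (N - n) n N π (by omega)).symm
  rw [Measure.real, h2, ENNReal.toReal_ofReal (h0 _ _)]

/-- The bijection between laws and weights respects mixtures in both directions; measures take
scalars in `ℝ≥0` and weights in `ℝ`, so the coefficients are transported. -/
theorem HasWeight.mem_extremePoints_iff {μ : Measure VirtualPerm} {v : ℕ → ℕ → ℝ}
    (h : HasWeight μ v) (hv : v ∈ weightSet) :
    μ ∈ Set.extremePoints ℝ≥0 issLaws ↔ v ∈ Set.extremePoints ℝ weightSet := by
  have hμ := h.1
  constructor
  · rintro ⟨-, hext⟩
    refine ⟨hv, fun x hx y hy hxy => ?_⟩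
    obtain ⟨s, t, hs, ht, hst, rfl⟩ := hxy
    obtain ⟨α, hα⟩ := exists_hasWeight hx
    obtain ⟨β, hβ⟩ := exists_hasWeight hy
    have := hα.1
    have := hβ.1
    lift s to ℝ≥0 using hs.le
    lift t to ℝ≥0 using ht.le
    have hst' : s + t = 1 := by exact_mod_cast hst
    have hsum : HasWeight (s • α + t • β) ((s : ℝ) • x + (t : ℝ) • y) := by
      refine ⟨⟨?_⟩, fun n π => ?_⟩
      · rw [Measure.add_apply, Measure.smul_apply, Measure.smul_apply, measure_univ, measure_univ,
          ENNReal.smul_def, ENNReal.smul_def, smul_eq_mul, smul_eq_mul, mul_one, mul_one]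
        exact_mod_cast hst'
      · rw [measureReal_add_apply, measureReal_nnreal_smul_apply, measureReal_nnreal_smul_apply,
          hα.2, hβ.2]
        rfl
    have hαμ := hext hα.mem_issLaws hβ.mem_issLaws
      ⟨s, t, by exact_mod_cast hs, by exact_mod_cast ht, hst', hsum.measure_eq h⟩
    exact (hαμ ▸ hα).weight_eq h hx hv
  · rintro ⟨-, hext⟩
    refine ⟨h.mem_issLaws, fun α hα β hβ hαβ => ?_⟩
    obtain ⟨s, t, hs, ht, hst, rfl⟩ := hαβ
    obtain ⟨x, hx, hαx⟩ := exists_weight_of_mem_issLaws hα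
    obtain ⟨y, hy, hβy⟩ := exists_weight_of_mem_issLaws hβ
    have := hαx.1
    have := hβy.1
    have hst' : (s : ℝ) + t = 1 := by exact_mod_cast hst
    have hsum : HasWeight (s • α + t • β) ((s : ℝ) • x + (t : ℝ) • y) := by
      refine ⟨hμ, fun n π => ?_⟩
      rw [measureReal_add_apply, measureReal_nnreal_smul_apply, measureReal_nnreal_smul_apply,
        hαx.2, hβy.2]
      rfl
    have hxv := hext hx hy ⟨s, t, by exact_mod_cast hs, by exact_mod_cast ht, hst',
      hsum.weight_eq h (convex_weightSet hx hy s.2 t.2 hst') hv⟩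
    exact (hxv ▸ hαx).measure_eq h

/-! ### The parameter `q` -/

/-- The homogeneous coordinates `(a, b)` of the parameter `q = b / a`. -/
noncomputable def homogeneousCoords (q : ℝ≥0∞) : ℝ × ℝ :=
  if q = ∞ then (0, 1) else (1, q.toReal)

theorem homogeneousCoords_nonneg (q : ℝ≥0∞) :
    0 ≤ (homogeneousCoords q).1 ∧ 0 ≤ (homogeneousCoords q).2 ∧
      0 < (homogeneousCoords q).1 + (homogeneousCoords q).2 := by
  unfold homogeneousCoords
  split_ifs
  · norm_num
  · have := q.toReal_nonneg
    exact ⟨zero_le_one, this, by positivity⟩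

/-- The harmonic function of the Mallows law. -/
noncomputable def mallowsWeight (q : ℝ≥0∞) : ℕ → ℕ → ℝ :=
  ratioWeight (homogeneousCoords q).1 (homogeneousCoords q).2

theorem mallowsWeight_mem_weightSet (q : ℝ≥0∞) : mallowsWeight q ∈ weightSet :=
  ratioWeight_mem_weightSet (homogeneousCoords_nonneg q).1 (homogeneousCoords_nonneg q).2.1
    (homogeneousCoords_nonneg q).2.2

/-- Only the ratio matters: `q = b / a`, with `a = 0` giving `q = ∞`. -/
theorem exists_ratioWeight_eq_mallowsWeight {a b : ℝ} (ha : 0 ≤ a) (hb : 0 ≤ b)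
    (hab : 0 < a + b) : ∃ q : ℝ≥0∞, ratioWeight a b = mallowsWeight q := by
  rcases ha.eq_or_lt with rfl | ha'
  · refine ⟨∞, eq_ratioWeight (ratioWeight_mem_weightSet ha hb hab) ?_ ?_ ?_ fun n k hk => ?_⟩ <;>
      simp only [homogeneousCoords, if_true]
    · exact le_rfl
    · exact zero_le_one
    · norm_num
    · have h := ratioWeight_ratio 0 b n k hk
      have hb' : b ≠ 0 := by linarith
      rw [zero_mul, eq_comm, mul_eq_zero, or_iff_right hb'] at h
      simp [h]
  · obtain ⟨h1, h2, h3⟩ := homogeneousCoords_nonneg (ENNReal.ofReal (b / a))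
    refine ⟨ENNReal.ofReal (b / a), eq_ratioWeight (ratioWeight_mem_weightSet ha hb hab) h1 h2 h3
      fun n k hk => ?_⟩
    have h := ratioWeight_ratio a b n k hk
    simp only [homogeneousCoords, ENNReal.ofReal_ne_top, if_false,
      ENNReal.toReal_ofReal (div_nonneg hb ha)]
    field_simp
    linarith

theorem mallowsProb_eq (q : ℝ≥0∞) {n : ℕ} (π : Equiv.Perm (Fin n)) :
    mallowsProb q π = ENNReal.ofReal (mallowsWeight q n (inversions π)) := by
  have hle := inversions_le π
  unfold mallowsProb mallowsWeight homogeneousCoords ratioWeight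
  rw [if_pos hle]
  split_ifs with hq hπ
  · have hone : ∀ m, ∑ j ∈ Finset.range (m + 1), (0 : ℝ) ^ (m - j) = 1 := by
      intro m
      rw [Finset.sum_range_succ, Finset.sum_eq_zero]
      · simp
      · intro j hj
        rw [Finset.mem_range] at hj
        rw [zero_pow (by omega)]
    simp [(inversions_eq_choose_iff π).2 hπ, hone]
  · have : n.choose 2 - inversions π ≠ 0 := fun h =>
      hπ ((inversions_eq_choose_iff π).1 (by omega))
    simp [zero_pow this]
  · lift q to ℝ≥0 using hq
    have hpos : qFactorial q n ≠ 0 := by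
      refine Finset.prod_ne_zero_iff.2 fun m _ h => ?_
      have := Finset.sum_eq_zero_iff.1 h 0 (by simp)
      simp at this
    rw [← ENNReal.ofReal_toReal (ENNReal.div_ne_top (ENNReal.pow_ne_top ENNReal.coe_ne_top) hpos)]
    congr 1
    have hfin : ∀ m, ∀ j ∈ Finset.range (m + 1), (q : ℝ≥0∞) ^ j ≠ ∞ :=
      fun m j _ => ENNReal.pow_ne_top ENNReal.coe_ne_top
    simp only [qFactorial, qNumber, ENNReal.toReal_div, ENNReal.toReal_prod, one_pow, one_mul,
      ENNReal.toReal_pow]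
    congr 1
    refine Finset.prod_congr rfl fun m _ => ?_
    rw [ENNReal.toReal_sum (hfin m)]
    simp

theorem isMallows_iff_hasWeight (q : ℝ≥0∞) (μ : Measure VirtualPerm) :
    IsMallows q μ ↔ HasWeight μ (mallowsWeight q) := by
  refine and_congr_right fun hμ => forall_congr' fun n => forall_congr' fun π => ?_
  rw [mallowsProb_eq, Measure.real, ← ENNReal.toReal_eq_toReal_iff' (measure_ne_top _ _)
    ENNReal.ofReal_ne_top, ENNReal.toReal_ofReal ((mallowsWeight_mem_weightSet q).1.1 _ _)]

end KendallTau

theorem theorem3 :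
    (∀ q : ℝ≥0∞, ∃! μ : Measure KendallTau.VirtualPerm, KendallTau.IsMallows q μ) ∧
    (∀ μ : Measure KendallTau.VirtualPerm,
      μ ∈ Set.extremePoints ℝ≥0 KendallTau.issLaws ↔ ∃ q : ℝ≥0∞, KendallTau.IsMallows q μ) := by
  open KendallTau in
  simp only [isMallows_iff_hasWeight]
  refine ⟨fun q => ?_, fun μ => ⟨fun h => ?_, ?_⟩⟩
  · obtain ⟨μ, hμ⟩ := exists_hasWeight (mallowsWeight_mem_weightSet q)
    exact ⟨μ, hμ, fun ν hν => hν.measure_eq hμ⟩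
  · obtain ⟨v, hv, hμv⟩ := exists_weight_of_mem_issLaws h.1
    obtain ⟨a, b, ha, hb, hab, rfl⟩ :=
      extremePoints_weightSet_eq_ratioWeight ((hμv.mem_extremePoints_iff hv).1 h)
    obtain ⟨q, hq⟩ := exists_ratioWeight_eq_mallowsWeight ha hb hab
    exact ⟨q, hq ▸ hμv⟩
  · rintro ⟨q, hq⟩
    obtain ⟨h1, h2, h3⟩ := homogeneousCoords_nonneg q
    exact (hq.mem_extremePoints_iff (mallowsWeight_mem_weightSet q)).2
      (ratioWeight_mem_extremePoints h1 h2 h3)
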